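/- A semifield is a set $\mathbb F$ with a commutative, associative addition and a multiplication that makes $\mathbb F$ an abelian group and distributes over addition (so there is no zero element; for example $\mathbb R_{>0}$, or $\mathbb R$ with $\max$ as addition and $+$ as multiplication). Let $m,n$ be positive integers and let $$\mathcal L=\{(x,y,t)\in\mathbb Z^3 : 0\le x\le m,\ 0\le y\le n,\ x+y+t \text{ even}\}.$$ A function $f:\mathcal L\to\mathbb F$ satisfies the bounded octahedron recurrence if for every $(x,y,t)\in\mathbb Z^3$ with $(x,y,t+1)\in\mathcal L$ the product $f(x,y,t+1)\,f(x,y,t-1)$ is equal to - $f(x+1,y,t)f(x-1,y,t)+f(x,y+1,t)f(x,y-1,t)$ if $0<x<m$ and $0<y<n$; - $f(x+1,y,t)f(x-1,y,t)$ if $0<x<m$ and $y\in\{0,n\}$; - $f(x,y+1,t)f(x,y-1,t)$ if $0<y<n$ and $x\in\{0,m\}$; - $f(x+1,y,t)f(x,y+1,t)$ if $(x,y)=(0,0)$; - $f(x+1,y,t)f(x,y-1,t)$ if $(x,y)=(0,n)$; - $f(x-1,y,t)f(x,y+1,t)$ if $(x,y)=(m,0)$; - $f(x-1,y,t)f(x,y-1,t)$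 if $(x,y)=(m,n)$. **Theorem 1.** Let $f:\mathcal L\to\mathbb F$ satisfy the bounded octahedron recurrence. Then there is a constant $c\in\mathbb F$ such that for every $(x,y,t)\in\mathcal L$ $$f(x,y,t)=c\cdot f(m-x,\,n-y,\,t-m-n).$$ -/

import Mathlib

/-- The lattice `𝓛` of integer points `(x, y, t)` with `0 ≤ x ≤ m`, `0 ≤ y ≤ n` and
`x + y + t` even. -/
def boundedLattice (m n : ℤ) : Set (ℤ × ℤ × ℤ) :=
  {p | 0 ≤ p.1 ∧ p.1 ≤ m ∧ 0 ≤ p.2.1 ∧ p.2.1 ≤ n ∧ Even (p.1 + p.2.1 + p.2.2)}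

/-- The function `f` satisfies the bounded octahedron recurrence at every point of the lattice
`boundedLattice m n`.  Seven clauses: interior, the two pairs of walls, and the four vertical
edges.  When `(x, y, t + 1)` is a lattice point, every value of `f` occurring in the clause that
applies is the value at a lattice point, so only the restriction of `f` to the lattice matters. -/
def SatisfiesBoundedOctahedron {F : Type*} [CommGroup F] [AddCommSemigroup F]
    (m n : ℤ) (f : ℤ → ℤ → ℤ → F) : Prop :=
  ∀ x y t : ℤ, (x, y, t + 1) ∈ boundedLattice m n →
    (0 < x → x < m → 0 < y → y < n →
      f x y (t + 1) =
        (f (x + 1) y t * f (x - 1) y t + f x (y + 1) t * f x (y - 1) t) / f x y (t - 1)) ∧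
    (0 < x → x < m → (y = 0 ∨ y = n) →
      f x y (t + 1) = f (x + 1) y t * f (x - 1) y t / f x y (t - 1)) ∧
    (0 < y → y < n → (x = 0 ∨ x = m) →
      f x y (t + 1) = f x (y + 1) t * f x (y - 1) t / f x y (t - 1)) ∧
    (x = 0 → y = 0 →
      f x y (t + 1) = f (x + 1) y t * f x (y + 1) t / f x y (t - 1)) ∧
    (x = 0 → y = n →
      f x y (t + 1) = f (x + 1) y t * f x (y - 1) t / f x y (t - 1)) ∧
    (x = m → y = 0 →
      f x y (t + 1) = f (x - 1) y t * f x (y + 1) t / f x y (t - 1)) ∧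
    (x = m → y = n →
      f x y (t + 1) = f (x - 1) y t * f x (y - 1) t / f x y (t - 1))

/-! Over the positive reals the recurrence is solved by determinants. Take vectors `v s` in `ℝ^m`
with `v (s + m + n) = (-1)^(m-1) • v s`, scalars with `a (s + m + n) = lam * a s`, and a constant
`κ`. With `j = i + x + y`, let `D` be the determinant of `x` consecutive vectors from `v i` and `m -
x` from `v j`, where `i` is `(t - x - y) / 2` up to a shift. Then `κ * a i * a j * D` is a solution:
inside, this is a three-term Plücker relation (`twoBlockDet_plucker`); on the walls each determinant
is that of a single window of consecutive vectors.

Modulo `m + n` the two blocks lie on a circle, separated by gaps of `y` and `n - y`. The map of the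
theorem interchanges the blocks, and the sign in the quasi-period cancels the sign of the cyclic
shift (`twoBlockDet_reflect`), so only the factor `lam` appears.

Every positive choice of values on the surface `t = x - y` comes from such a solution
(`exists_real_solution`), and the recurrence expresses all other values through these without
subtraction. Once the constant is eliminated by cross-multiplication, the claim is an identity of
subtraction-free expressions. True at all positive reals, it becomes an identity of polynomials over
`ℕ`, and so holds in every semifield (`SubtractionFreeLift.eq_of_eq`). -/

/-! ### Plücker relation for two blocks of consecutive vectors. -/

/-- The exchange relation between two determinants: a row of `B` is traded for each row of `A`. -/
theorem det_mul_det_eq_sum_exchange {ι R : Type*} [Fintype ι] [DecidableEq ι] [CommRing R]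
    (A B : Matrix ι ι R) (r : ι) :
    A.det * B.det = ∑ k, (A.updateRow k (B r)).det * (B.updateRow r (A k)).det := by
  -- Cramer's rule expands `B r` in the rows of `A`; the linear functional `φ` is then applied to
  -- both sides.
  have h1 : A.det • B r = ∑ k, (A.updateRow k (B r)).det • A k := by
    have h := Matrix.mulVec_cramer A.transpose (B r)
    rw [Matrix.det_transpose] at h
    rw [← h]
    ext l
    simp [Matrix.mulVec, dotProduct, Matrix.cramer_transpose_apply, mul_comm]
  let φ : (ι → R) →ₗ[R] R :=
    (Matrix.detRowAlternating (n := ι) (R := R)).toMultilinearMap.toLinearMap B r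
  have hφ : ∀ u, φ u = (B.updateRow r u).det := fun u => rfl
  have h2 := congrArg φ h1
  rw [map_smul, map_sum] at h2
  simp only [map_smul, smul_eq_mul] at h2
  simp only [hφ, Matrix.updateRow_eq_self] at h2
  exact h2

/-- Two determinants whose rows are permuted oppositely have the same product. -/
theorem det_mul_det_of_perm {ι R : Type*} [Fintype ι] [DecidableEq ι] [CommRing R]
    (ρ : Equiv.Perm ι) {A B E G : Matrix ι ι R} (hA : ∀ k, A (ρ k) = E k)
    (hB : ∀ k, B k = G (ρ k)) : A.det * B.det = E.det * G.det := by
  have h1 : E = A.submatrix ρ id := by ext k l; simp [hA]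
  have h2 : B = G.submatrix ρ id := by ext k l; simp [hB]
  rw [h1, h2, Matrix.det_permute, Matrix.det_permute]
  ring

/-- The cyclic permutation of the indices `≥ x`. -/
theorem exists_perm_cycle_from (m : ℕ) (x : Fin m) :
    ∃ ρ : Equiv.Perm (Fin m), ∀ k : Fin m,
      ((ρ k : Fin m) : ℕ) = if (k : ℕ) < x then (k : ℕ) else if (k : ℕ) + 1 < m then k + 1 else x := by
  let g : Fin m → Fin m := fun k =>
    ⟨if (k : ℕ) < x then (k : ℕ) else if (k : ℕ) + 1 < m then k + 1 else x, by
      split_ifs <;> omega⟩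
  have hg : Function.Injective g := by
    intro k l h
    have h' := congrArg Fin.val h
    simp only [g] at h'
    ext
    split_ifs at h' <;> omega
  exact ⟨Equiv.ofBijective g (Finite.injective_iff_bijective.mp hg), fun k => rfl⟩

/-- The matrix whose rows are `x` consecutive vectors starting at `v i`, followed by `m - x`
consecutive vectors starting at `v (J + x)`. -/
def twoBlockMatrix (m : ℕ) (v : ℤ → ℕ → ℝ) (x i J : ℤ) : Matrix (Fin m) (Fin m) ℝ :=
  fun k l => v (if (k : ℤ) < x then i + k else J + k) l

/-- The determinant of `twoBlockMatrix`. -/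
noncomputable def twoBlockDet (m : ℕ) (v : ℤ → ℕ → ℝ) (x i J : ℤ) : ℝ :=
  (twoBlockMatrix m v x i J).det

theorem twoBlockDet_congr {m : ℕ} {v : ℤ → ℕ → ℝ} {x i J x' i' J' : ℤ}
    (h : ∀ k : ℕ, k < m → (if (k : ℤ) < x then i + k else J + k) =
      (if (k : ℤ) < x' then i' + k else J' + k)) :
    twoBlockDet m v x i J = twoBlockDet m v x' i' J' := by
  unfold twoBlockDet
  congr 1
  ext k l
  simp only [twoBlockMatrix, h k k.2]

theorem twoBlockDet_plucker (m : ℕ) (v : ℤ → ℕ → ℝ) (x i J : ℤ) (hx : 0 < x) (hxm : x < m) :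
    twoBlockDet m v x (i + 1) (J + 1) * twoBlockDet m v x i J =
      twoBlockDet m v (x + 1) i J * twoBlockDet m v (x - 1) (i + 1) (J + 1) +
      twoBlockDet m v x i (J + 1) * twoBlockDet m v x (i + 1) J := by
  lift x to ℕ using hx.le
  have hx' : 0 < x := by omega
  have hxm' : x < m := by omega
  let last : Fin m := ⟨m - 1, by omega⟩
  let z : Fin m := ⟨0, by omega⟩
  let c : Fin m := ⟨x, hxm'⟩
  set A := twoBlockMatrix m v x i J with hAdef
  set B := twoBlockMatrix m v x (i + 1) (J + 1) with hBdef
  have hzc : z ≠ c := by simp only [z, c, ne_eq, Fin.mk.injEq]; omega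
  have key := det_mul_det_eq_sum_exchange A B last
  have hBl : ∀ l, B last l = v (J + m) l := by
    intro l
    simp only [hBdef, twoBlockMatrix, last]
    rw [if_neg (by omega)]
    congr 1; omega
  have hsum : ∑ k, (A.updateRow k (B last)).det * (B.updateRow last (A k)).det =
      ∑ k ∈ {z, c}, (A.updateRow k (B last)).det * (B.updateRow last (A k)).det := by
    symm
    apply Finset.sum_subset (Finset.subset_univ _)
    intro k _ hk
    simp only [Finset.mem_insert, Finset.mem_singleton, not_or, z, c, Fin.ext_iff] at hk
    -- Row `k` of `A` is already row `k - 1` of `B`, except where a block of `A` begins.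
    apply mul_eq_zero_of_right
    let k' : Fin m := ⟨k - 1, by omega⟩
    have hk' : k' ≠ last := by simp only [k', last, ne_eq, Fin.mk.injEq]; omega
    apply Matrix.det_zero_of_row_eq hk'
    rw [Matrix.updateRow_ne hk', Matrix.updateRow_self]
    ext l
    simp only [hAdef, hBdef, twoBlockMatrix, k']
    congr 1
    split_ifs <;> omega
  rw [hsum, Finset.sum_pair hzc] at key
  have e1 : (A.updateRow z (B last)).det * (B.updateRow last (A z)).det =
      twoBlockDet m v (x - 1) (i + 1) (J + 1) * twoBlockDet m v (x + 1) i J := by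
    -- Sorting moves `v (J + m)` from the top to the bottom of one matrix and `v i` from the bottom
    -- to the top of the other: opposite cycles, whose signs cancel.
    obtain ⟨ρ, hρ⟩ := exists_perm_cycle_from m z
    refine det_mul_det_of_perm ρ (fun k => ?_) (fun k => ?_)
    · have h := hρ k
      ext l
      simp only [z, not_lt_zero, if_false] at h
      by_cases hk : (k : ℕ) + 1 < m
      · rw [if_pos hk] at h
        rw [Matrix.updateRow_ne (by simp only [ne_eq, z, Fin.ext_iff]; omega)]
        simp only [hAdef, twoBlockMatrix, h]
        congr 1
        split_ifs <;> omega
      · rw [if_neg hk] at h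
        have hz : ρ k = z := Fin.ext h
        rw [hz, Matrix.updateRow_self, hBl]
        simp only [twoBlockMatrix]
        congr 1
        split_ifs <;> omega
    · have h := hρ k
      ext l
      simp only [z, not_lt_zero, if_false] at h
      by_cases hk : (k : ℕ) + 1 < m
      · rw [if_pos hk] at h
        rw [Matrix.updateRow_ne (by simp only [ne_eq, last, Fin.ext_iff]; omega)]
        simp only [hBdef, twoBlockMatrix, h]
        congr 1
        split_ifs <;> omega
      · rw [if_neg hk] at h
        have hz : k = last := by simp only [last, Fin.ext_iff]; omega
        rw [hz] at h ⊢
        rw [Matrix.updateRow_self]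
        simp only [hAdef, twoBlockMatrix, h, z]
        congr 1
        split_ifs <;> omega
  have e2 : (A.updateRow c (B last)).det * (B.updateRow last (A c)).det =
      twoBlockDet m v x i (J + 1) * twoBlockDet m v x (i + 1) J := by
    obtain ⟨ρ, hρ⟩ := exists_perm_cycle_from m c
    refine det_mul_det_of_perm ρ (fun k => ?_) (fun k => ?_)
    · have h := hρ k
      ext l
      simp only [c] at h
      by_cases hk : (k : ℕ) + 1 = m
      · rw [if_neg (by omega), if_neg (by omega)] at h
        have hz : ρ k = c := Fin.ext h
        rw [hz, Matrix.updateRow_self, hBl]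
        simp only [twoBlockMatrix]
        congr 1
        split_ifs <;> omega
      · rw [Matrix.updateRow_ne (by
          simp only [ne_eq, c, Fin.ext_iff]; split_ifs at h <;> omega)]
        simp only [hAdef, twoBlockMatrix, h]
        congr 1
        split_ifs <;> omega
    · have h := hρ k
      ext l
      simp only [c] at h
      by_cases hk : (k : ℕ) + 1 = m
      · rw [if_neg (by omega), if_neg (by omega)] at h
        have hz : k = last := by simp only [last, Fin.ext_iff]; omega
        rw [hz] at h ⊢
        rw [Matrix.updateRow_self]
        simp only [hAdef, twoBlockMatrix, h, c]
        congr 1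
        split_ifs <;> omega
      · rw [Matrix.updateRow_ne (by simp only [ne_eq, last, Fin.ext_iff]; omega)]
        simp only [hBdef, twoBlockMatrix, h]
        congr 1
        split_ifs <;> omega
  rw [e1, e2] at key
  change B.det * A.det = _
  rw [mul_comm B.det, key]
  ring

/-! ### Cyclic symmetry of the determinants. -/

/-- Sliding a window of `m` vectors by one step along a sequence that is quasi-periodic with
factor `(-1) ^ (m - 1)` does not change its determinant. -/
theorem det_window_succ (m : ℕ) (c : ℕ → ℕ → ℝ) (s : ℕ)
    (h : c (s + m) = (-1 : ℝ) ^ (m - 1) • c s) :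
    (Matrix.of fun k l : Fin m => c (s + 1 + k) l).det =
      (Matrix.of fun k l : Fin m => c (s + k) l).det := by
  obtain _ | p := m
  · simp
  set A : Matrix (Fin (p + 1)) (Fin (p + 1)) ℝ := Matrix.of fun k l => c (s + k) l with hA
  set A' := A.submatrix (finRotate (p + 1)) id with hA'
  have h1 : (Matrix.of fun k l : Fin (p + 1) => c (s + 1 + k) l) =
      A'.updateRow (Fin.last p) (((-1 : ℝ) ^ p) • A' (Fin.last p)) := by
    ext k l
    by_cases hk : k = Fin.last p
    · subst hk
      simp only [Matrix.updateRow_self, hA', hA, Matrix.of_apply, Pi.smul_apply,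
        Matrix.submatrix_apply, finRotate_last, id, Fin.val_last, Fin.val_zero, add_zero]
      have := congrFun h l
      simp only [Nat.add_sub_cancel, Pi.smul_apply] at this
      rw [← this]
      congr 1; ring
    · have hlt : (k : ℕ) < p := Fin.val_lt_last hk
      rw [Matrix.updateRow_ne hk]
      simp only [hA', hA, Matrix.of_apply, Matrix.submatrix_apply, id]
      have : ((finRotate (p + 1) k : Fin (p + 1)) : ℕ) = k + 1 := coe_finRotate_of_ne_last hk
      rw [this]
      congr 1; ring
  rw [h1, Matrix.det_updateRow_smul, Matrix.updateRow_eq_self, hA', Matrix.det_permute,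
    sign_finRotate]
  push_cast
  rw [← mul_assoc, ← pow_add]
  simp [← two_mul]

theorem twoBlockDet_reflect (m : ℕ) (n : ℤ) (v : ℤ → ℕ → ℝ)
    (hv : ∀ s, v (s + (m + n)) = (-1 : ℝ) ^ (m - 1) • v s) (x i J : ℤ) (hx : 0 ≤ x) (hxm : x ≤ m) :
    twoBlockDet m v x i J = twoBlockDet m v (m - x) (J + x) (i + x + n) := by
  lift x to ℕ using hx
  have hxm' : x ≤ m := by omega
  -- First block, second block, then the first block one period later. Sliding the window `x` times
  -- passes from the first two pieces to the last two.
  let c : ℕ → ℕ → ℝ := fun k =>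
    v (if k < x then i + k else if k < m then J + k else i + k + n)
  have hc : ∀ s, s ≤ x → (Matrix.of fun k l : Fin m => c (s + k) l).det =
      (Matrix.of fun k l : Fin m => c (0 + k) l).det := by
    intro s
    induction s with
    | zero => intro _; rfl
    | succ s ih =>
      intro hs
      rw [← ih (by omega)]
      apply det_window_succ
      simp only [c]
      rw [if_neg (by omega), if_neg (by omega), if_pos (by omega), ← hv]
      congr 1; push_cast; ring
  have h0 : twoBlockMatrix m v x i J = (Matrix.of fun k l : Fin m => c (0 + k) l) := by
    ext k l
    simp only [twoBlockMatrix, c, Matrix.of_apply]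
    congr 1
    split_ifs <;> omega
  have h1 : twoBlockMatrix m v (m - x) (J + x) (i + x + n) =
      (Matrix.of fun k l : Fin m => c (x + k) l) := by
    ext k l
    simp only [twoBlockMatrix, c, Matrix.of_apply]
    congr 1
    split_ifs <;> omega
  rw [twoBlockDet, twoBlockDet, h0, h1, hc x le_rfl]

theorem twoBlockDet_add_period (m : ℕ) (n : ℤ) (v : ℤ → ℕ → ℝ)
    (hv : ∀ s, v (s + (m + n)) = (-1 : ℝ) ^ (m - 1) • v s) (x i J : ℤ) (hx : 0 ≤ x) (hxm : x ≤ m) :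
    twoBlockDet m v x (i + (m + n)) (J + (m + n)) = twoBlockDet m v x i J := by
  rw [twoBlockDet_reflect m n v hv x i J hx hxm,
    twoBlockDet_reflect m n v hv (m - x) _ _ (by omega) (by omega)]
  congr 1 <;> ring

/-! ### Transfer of subtraction-free identities to semifields. -/

/-- Adjoining a zero to a semifield gives a commutative semiring. -/
@[reducible] def withZeroCommSemiring (F : Type*) [CommGroup F] [AddCommSemigroup F]
    [LeftDistribClass F] : CommSemiring (WithZero F) :=
  { (inferInstance : CommMonoidWithZero (WithZero F)),
    (inferInstance : AddCommMonoid (WithZero F)) with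
    left_distrib := by
      intro a b c
      induction a <;> induction b <;> induction c <;>
        simp [← WithZero.coe_add, ← WithZero.coe_mul, mul_add]
    right_distrib := by
      intro a b c
      induction a <;> induction b <;> induction c <;>
        simp [← WithZero.coe_add, ← WithZero.coe_mul, mul_add, mul_comm] }

attribute [local instance] withZeroCommSemiring

/-- The positive orthant is a product of infinite sets, so a real polynomial is determined by its
values there. -/
theorem mvPolynomial_nat_eq_of_pos {σ : Type*} {P Q : MvPolynomial σ ℕ}
    (h : ∀ d : σ → ℝ, (∀ s, 0 < d s) → MvPolynomial.aeval d P = MvPolynomial.aeval d Q) :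
    P = Q := by
  apply MvPolynomial.map_injective (Nat.castRingHom ℝ) Nat.cast_injective
  apply MvPolynomial.funext_set (fun _ => Set.Ioi (0 : ℝ)) (fun _ => Set.Ioi_infinite 0)
  intro d hd
  have := h d (fun s => hd s (Set.mem_univ s))
  rw [MvPolynomial.aeval_def, MvPolynomial.aeval_def] at this
  rw [MvPolynomial.eval_map, MvPolynomial.eval_map, Subsingleton.elim (Nat.castRingHom ℝ) (algebraMap ℕ ℝ)]
  exact this

/-- `a` is a value, at the point `φ` of a semifield, of a quotient of polynomials with natural
coefficients whose values at positive real points are given by `b`. -/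
def SubtractionFreeLift {F σ : Type*} [CommGroup F] [AddCommSemigroup F] [LeftDistribClass F]
    (φ : σ → F) (a : F) (b : (σ → ℝ) → ℝ) : Prop :=
  ∃ P Q : MvPolynomial σ ℕ,
    (MvPolynomial.aeval (fun s => (φ s : WithZero F)) P ≠ 0 ∧
      MvPolynomial.aeval (fun s => (φ s : WithZero F)) Q ≠ 0 ∧
      (a : WithZero F) * MvPolynomial.aeval (fun s => (φ s : WithZero F)) Q =
        MvPolynomial.aeval (fun s => (φ s : WithZero F)) P) ∧
    ∀ d : σ → ℝ, (∀ s, 0 < d s) →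
      0 < MvPolynomial.aeval d P ∧ 0 < MvPolynomial.aeval d Q ∧
        b d * MvPolynomial.aeval d Q = MvPolynomial.aeval d P

namespace SubtractionFreeLift

variable {F σ : Type*} [CommGroup F] [AddCommSemigroup F] [LeftDistribClass F] {φ : σ → F}
  {a a' : F} {b b' : (σ → ℝ) → ℝ}

theorem of_var (s : σ) (hb : ∀ d : σ → ℝ, (∀ s, 0 < d s) → b d = d s) :
    SubtractionFreeLift φ (φ s) b :=
  ⟨.X s, 1, by simp, fun d hd => by simp [hb d hd, hd s]⟩

theorem congr_right (h : SubtractionFreeLift φ a b)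
    (hb : ∀ d : σ → ℝ, (∀ s, 0 < d s) → b' d = b d) : SubtractionFreeLift φ a b' := by
  obtain ⟨P, Q, h1, h2⟩ := h
  exact ⟨P, Q, h1, fun d hd => by rw [hb d hd]; exact h2 d hd⟩

theorem pos (h : SubtractionFreeLift φ a b) (d : σ → ℝ) (hd : ∀ s, 0 < d s) : 0 < b d := by
  obtain ⟨P, Q, -, h2⟩ := h
  obtain ⟨hP, hQ, e⟩ := h2 d hd
  exact pos_of_mul_pos_left (e ▸ hP) hQ.le

theorem mul (h : SubtractionFreeLift φ a b) (h' : SubtractionFreeLift φ a' b') :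
    SubtractionFreeLift φ (a * a') (fun d => b d * b' d) := by
  obtain ⟨P, Q, ⟨hP, hQ, e⟩, h2⟩ := h
  obtain ⟨P', Q', ⟨hP', hQ', e'⟩, h2'⟩ := h'
  refine ⟨P * P', Q * Q', ⟨?_, ?_, ?_⟩, fun d hd => ?_⟩
  · rw [map_mul]; exact mul_ne_zero hP hP'
  · rw [map_mul]; exact mul_ne_zero hQ hQ'
  · rw [map_mul, map_mul, ← e, ← e', WithZero.coe_mul]; ring
  · obtain ⟨p, q, r⟩ := h2 d hd
    obtain ⟨p', q', r'⟩ := h2' d hd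
    refine ⟨by rw [map_mul]; positivity, by rw [map_mul]; positivity, ?_⟩
    rw [map_mul, map_mul, ← r, ← r']; ring

theorem add (h : SubtractionFreeLift φ a b) (h' : SubtractionFreeLift φ a' b') :
    SubtractionFreeLift φ (a + a') (fun d => b d + b' d) := by
  obtain ⟨P, Q, ⟨hP, hQ, e⟩, h2⟩ := h
  obtain ⟨P', Q', ⟨hP', hQ', e'⟩, h2'⟩ := h'
  have e3 : ((a + a' : F) : WithZero F) *
      MvPolynomial.aeval (fun s => (φ s : WithZero F)) (Q * Q') =
      MvPolynomial.aeval (fun s => (φ s : WithZero F)) (P * Q' + P' * Q) := by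
    rw [map_add, map_mul, map_mul, map_mul, ← e, ← e', WithZero.coe_add]; ring
  have hQQ : MvPolynomial.aeval (fun s => (φ s : WithZero F)) (Q * Q') ≠ 0 := by
    rw [map_mul]; exact mul_ne_zero hQ hQ'
  refine ⟨P * Q' + P' * Q, Q * Q', ⟨?_, hQQ, e3⟩, fun d hd => ?_⟩
  -- The numerator's value is nonzero because `a + a'` lies in `F`, which has no zero.
  · rw [← e3]; exact mul_ne_zero WithZero.coe_ne_zero hQQ
  · obtain ⟨p, q, r⟩ := h2 d hd
    obtain ⟨p', q', r'⟩ := h2' d hd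
    refine ⟨by simp only [map_add, map_mul]; positivity, by rw [map_mul]; positivity, ?_⟩
    simp only [map_add, map_mul, ← r, ← r']; ring

/-- Division, in the form in which it is used by the recurrence. -/
theorem of_mul {e : F} {g : (σ → ℝ) → ℝ} (h : SubtractionFreeLift φ a b)
    (h' : SubtractionFreeLift φ a' b') (he : e * a = a') (hg : ∀ d, g d * b d = b' d) :
    SubtractionFreeLift φ e g := by
  have hpos := h.pos
  obtain ⟨P, Q, ⟨hP, hQ, e1⟩, h2⟩ := h
  obtain ⟨P', Q', ⟨hP', hQ', e1'⟩, h2'⟩ := h'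
  refine ⟨P' * Q, Q' * P, ⟨?_, ?_, ?_⟩, fun d hd => ?_⟩
  · rw [map_mul]; exact mul_ne_zero hP' hQ
  · rw [map_mul]; exact mul_ne_zero hQ' hP
  · rw [map_mul, map_mul, ← e1, ← e1', ← he, WithZero.coe_mul]; ring
  · obtain ⟨p, q, r⟩ := h2 d hd
    obtain ⟨p', q', r'⟩ := h2' d hd
    refine ⟨by rw [map_mul]; positivity, by rw [map_mul]; positivity, ?_⟩
    rw [map_mul, map_mul, ← r, ← r', ← hg]; ring

/-- The transfer principle: agreement at positive reals gives `P * Q' = P' * Q` over `ℕ`, which is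
evaluated at `φ`; the denominators are nonzero there and cancel. -/
theorem eq_of_eq (h : SubtractionFreeLift φ a b) (h' : SubtractionFreeLift φ a' b')
    (hb : ∀ d : σ → ℝ, (∀ s, 0 < d s) → b d = b' d) : a = a' := by
  obtain ⟨P, Q, ⟨hP, hQ, e⟩, h2⟩ := h
  obtain ⟨P', Q', ⟨hP', hQ', e'⟩, h2'⟩ := h'
  have hpoly : P * Q' = P' * Q := by
    apply mvPolynomial_nat_eq_of_pos
    intro d hd
    obtain ⟨p, q, r⟩ := h2 d hd
    obtain ⟨p', q', r'⟩ := h2' d hd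
    rw [map_mul, map_mul, ← r, ← r', hb d hd]; ring
  have := congrArg (MvPolynomial.aeval (fun s => (φ s : WithZero F))) hpoly
  rw [map_mul, map_mul, ← e, ← e'] at this
  have h3 : (a : WithZero F) * (MvPolynomial.aeval (fun s => (φ s : WithZero F)) Q *
      MvPolynomial.aeval (fun s => (φ s : WithZero F)) Q') =
      a' * (MvPolynomial.aeval (fun s => (φ s : WithZero F)) Q *
      MvPolynomial.aeval (fun s => (φ s : WithZero F)) Q') := by
    rw [← mul_assoc, this]; ring
  exact WithZero.coe_injective (mul_right_cancel₀ (mul_ne_zero hQ hQ') h3)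

end SubtractionFreeLift

/-! ### Quasi-periodic sequences and vectors with prescribed minors. -/

/-- The extension to `ℤ` of the values of `w` on `[0, N)` which is multiplied by `u` when its
argument grows by `N`. -/
noncomputable def quasiPeriodicExt {V : Type*} [AddCommGroup V] [Module ℝ V] (N : ℤ) (u : ℝ)
    (w : ℤ → V) (s : ℤ) : V :=
  u ^ (s / N) • w (s % N)

theorem quasiPeriodicExt_add {V : Type*} [AddCommGroup V] [Module ℝ V] {N : ℤ} (hN : 0 < N)
    {u : ℝ} (hu : u ≠ 0) (w : ℤ → V) (s : ℤ) :
    quasiPeriodicExt N u w (s + N) = u • quasiPeriodicExt N u w s := by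
  unfold quasiPeriodicExt
  rw [Int.add_ediv_of_dvd_right (dvd_refl N), Int.ediv_self hN.ne', Int.add_emod_right,
    zpow_add_one₀ hu, smul_smul, mul_comm]

theorem quasiPeriodicExt_of_lt {V : Type*} [AddCommGroup V] [Module ℝ V] {N : ℤ}
    (u : ℝ) (w : ℤ → V) {s : ℤ} (h0 : 0 ≤ s) (hs : s < N) : quasiPeriodicExt N u w s = w s := by
  unfold quasiPeriodicExt
  rw [Int.ediv_eq_zero_of_lt h0 hs, Int.emod_eq_of_lt h0 hs, zpow_zero, one_smul]

theorem det_of_last_row_single {b : ℕ} (A : Matrix (Fin (b + 1)) (Fin (b + 1)) ℝ)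
    (h : ∀ l : Fin b, A (Fin.last b) l.castSucc = 0) :
    A.det = A (Fin.last b) (Fin.last b) * (A.submatrix Fin.castSucc Fin.castSucc).det := by
  rw [Matrix.det_succ_row A (Fin.last b), Fin.sum_univ_castSucc, Finset.sum_eq_zero]
  · simp [← two_mul, Fin.succAbove_last]
  · intro l _
    simp [h l]

/-- The minor of `w` in the rows `l < b` and the columns `s, …, s + b - 1`. -/
noncomputable def leadingMinor (w : ℕ → ℕ → ℝ) (b s : ℕ) : ℝ :=
  (Matrix.of fun k l : Fin b => w l (s + k)).det

theorem leadingMinor_congr {w w' : ℕ → ℕ → ℝ} {b : ℕ} (h : ∀ l < b, w l = w' l) (s : ℕ) :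
    leadingMinor w b s = leadingMinor w' b s := by
  unfold leadingMinor
  congr 1
  ext k l
  simp [h l l.2]

theorem leadingMinor_succ (w : ℕ → ℕ → ℝ) (b s : ℕ) :
    leadingMinor w (b + 1) s = ∑ k : Fin (b + 1),
      ((-1) ^ ((k : ℕ) + b) *
        (Matrix.of fun k' l' : Fin b => w l' (s + (k.succAbove k' : Fin (b + 1)))).det) *
        w b (s + k) := by
  unfold leadingMinor
  rw [Matrix.det_succ_column _ (Fin.last b)]
  refine Finset.sum_congr rfl fun k _ => ?_
  have : (Matrix.of fun k l : Fin (b + 1) => w l (s + k)).submatrix k.succAbove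
      (Fin.last b).succAbove =
      (Matrix.of fun k' l' : Fin b => w l' (s + (k.succAbove k' : Fin (b + 1)))) := by
    ext k' l'
    simp [Fin.succAbove_last]
  rw [this]
  simp only [Matrix.of_apply, Fin.val_last]
  ring

/-- Equation `s` determines `u (s + b)` from the `b` entries before it; the first `b` entries are
free and set to `0`. -/
theorem exists_band_solution (b : ℕ) (C : ℕ → Fin (b + 1) → ℝ) (T : ℕ → ℝ) (n : ℕ)
    (hC : ∀ s < n, C s (Fin.last b) ≠ 0) :
    ∃ u : ℕ → ℝ, (∀ j, n + b ≤ j → u j = 0) ∧ ∀ s < n, ∑ k, C s k * u (s + k) = T s := by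
  induction n with
  | zero => exact ⟨0, fun _ _ => rfl, fun s hs => absurd hs (Nat.not_lt_zero s)⟩
  | succ n ih =>
    obtain ⟨u, hu0, hu⟩ := ih fun s hs => hC s (by omega)
    refine ⟨Function.update u (n + b)
      ((T n - ∑ k : Fin b, C n k.castSucc * u (n + k)) / C n (Fin.last b)), fun j hj => ?_,
      fun s hs => ?_⟩
    · rw [Function.update_of_ne (by omega)]
      exact hu0 j (by omega)
    · obtain hs' | rfl := Nat.lt_succ_iff_lt_or_eq.mp hs
      · rw [← hu s hs']
        refine Finset.sum_congr rfl fun k _ => ?_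
        rw [Function.update_of_ne (by have := k.2; omega)]
      · have hne := hC s hs
        rw [Fin.sum_univ_castSucc, Fin.val_last, Function.update_self, mul_div_cancel₀ _ hne]
        have : ∀ k : Fin b, Function.update u (s + b)
            ((T s - ∑ k : Fin b, C s k.castSucc * u (s + k)) / C s (Fin.last b))
            (s + (k.castSucc : Fin (b + 1))) = u (s + k) := fun k => by
          rw [Function.update_of_ne (by simp; omega), Fin.val_castSucc]
        simp only [this]
        ring

/-- Nonzero values of the leading minors can be prescribed. -/
theorem exists_leadingMinor_eq (n : ℕ) (e : ℕ → ℕ → ℝ) (he0 : ∀ s, e 0 s = 1)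
    (he : ∀ b s, e b s ≠ 0) (b : ℕ) :
    ∃ w : ℕ → ℕ → ℝ, (∀ l j, n + l < j → w l j = 0) ∧
      ∀ b' ≤ b, ∀ s ≤ n, leadingMinor w b' s = e b' s := by
  induction b with
  | zero =>
    refine ⟨0, fun _ _ _ => rfl, fun b' hb' s _ => ?_⟩
    obtain rfl : b' = 0 := by omega
    simp [leadingMinor, he0]
  | succ b ih =>
    obtain ⟨w, hw0, hw⟩ := ih
    -- Expanded along the new coordinate `u`, the minors of size `b + 1` form a band system whose
    -- top coefficient is, up to sign, the minor of size `b`. The `n + 1` equations `s = 0, …, n`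
    -- leave `u` zero beyond `n + b`.
    obtain ⟨u, hu0, hu⟩ := exists_band_solution b (fun s k => (-1) ^ ((k : ℕ) + b) *
        (Matrix.of fun k' l' : Fin b => w l' (s + (k.succAbove k' : Fin (b + 1)))).det)
      (e (b + 1)) (n + 1) (by
        intro s hs
        have h : (Matrix.of fun k' l' : Fin b =>
            w l' (s + ((Fin.last b).succAbove k' : Fin (b + 1)))).det = leadingMinor w b s := by
          simp [leadingMinor, Fin.succAbove_last]
        rw [h, hw b le_rfl s (by omega)]
        exact mul_ne_zero (pow_ne_zero _ (by norm_num)) (he b s))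
    refine ⟨Function.update w b u, fun l j hj => ?_, fun b' hb' s hs => ?_⟩
    · by_cases hl : l = b
      · subst hl
        rw [Function.update_self]
        exact hu0 j (by omega)
      · rw [Function.update_of_ne hl]
        exact hw0 l j hj
    · have hne : ∀ l < b, Function.update w b u l = w l := fun l hl =>
        Function.update_of_ne (by omega) _ _
      by_cases hb : b' ≤ b
      · rw [leadingMinor_congr (fun l hl => hne l (by omega)), hw b' hb s hs]
      · obtain rfl : b' = b + 1 := by omega
        rw [leadingMinor_succ, ← hu s (by omega)]
        refine Finset.sum_congr rfl fun k _ => ?_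
        rw [Function.update_self]
        congr 3
        ext k' l'
        simp [hne l' l'.2]

theorem leadingMinor_succ_of_vanish {n : ℕ} {w : ℕ → ℕ → ℝ} (hw : ∀ l j, n + l < j → w l j = 0)
    (b : ℕ) : leadingMinor w (b + 1) n = w b (n + b) * leadingMinor w b n := by
  unfold leadingMinor
  rw [det_of_last_row_single]
  · rfl
  · intro l
    simp only [Matrix.of_apply, Fin.val_last, Fin.val_castSucc]
    exact hw _ _ (by omega)

/-- The vector with index `n + k` has coordinate `k` equal to `1` and all earlier ones zero, so the
second block can be peeled off from the bottom. -/
theorem det_unitriangular_tail {n m : ℕ} {w : ℕ → ℕ → ℝ} (hw : ∀ l j, n + l < j → w l j = 0)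
    (hw1 : ∀ l < m, w l (n + l) = 1) (x s b : ℕ) (hxb : x ≤ b) (hbm : b ≤ m) :
    (Matrix.of fun k l : Fin b => w l (if (k : ℕ) < x then s + k else n + k)).det =
      leadingMinor w x s := by
  induction b, hxb using Nat.le_induction with
  | base =>
    unfold leadingMinor
    congr 1
    ext k l
    simp
  | succ b hxb ih =>
    rw [← ih (by omega), det_of_last_row_single]
    · simp only [Matrix.of_apply, Fin.val_last]
      rw [if_neg (by omega), hw1 b (by omega), one_mul]
      rfl
    · intro l
      simp only [Matrix.of_apply, Fin.val_last, Fin.val_castSucc]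
      rw [if_neg (by omega)]
      exact hw _ _ (by omega)

/-! ### Real solutions built from determinants. -/

/-- The bounded octahedron recurrence without divisions. -/
def OctahedronRelation {F : Type*} [Mul F] [Add F] (m n : ℤ) (f : ℤ → ℤ → ℤ → F) : Prop :=
  ∀ x y t : ℤ, (x, y, t + 1) ∈ boundedLattice m n →
    (0 < x → x < m → 0 < y → y < n →
      f x y (t + 1) * f x y (t - 1) =
        f (x + 1) y t * f (x - 1) y t + f x (y + 1) t * f x (y - 1) t) ∧
    (0 < x → x < m → (y = 0 ∨ y = n) →
      f x y (t + 1) * f x y (t - 1) = f (x + 1) y t * f (x - 1) y t) ∧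
    (0 < y → y < n → (x = 0 ∨ x = m) →
      f x y (t + 1) * f x y (t - 1) = f x (y + 1) t * f x (y - 1) t) ∧
    (x = 0 → y = 0 →
      f x y (t + 1) * f x y (t - 1) = f (x + 1) y t * f x (y + 1) t) ∧
    (x = 0 → y = n →
      f x y (t + 1) * f x y (t - 1) = f (x + 1) y t * f x (y - 1) t) ∧
    (x = m → y = 0 →
      f x y (t + 1) * f x y (t - 1) = f (x - 1) y t * f x (y + 1) t) ∧
    (x = m → y = n →
      f x y (t + 1) * f x y (t - 1) = f (x - 1) y t * f x (y - 1) t)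

/-- The solution of the recurrence attached to a sequence of vectors, a scalar sequence and a
constant. -/
noncomputable def pluckerSolution (m : ℕ) (n : ℤ) (κ : ℝ) (a : ℤ → ℝ) (v : ℤ → ℕ → ℝ)
    (x y t : ℤ) : ℝ :=
  κ * a ((t - x - y) / 2 + n) * a ((t + x + y) / 2 + n) *
    twoBlockDet m v x ((t - x - y) / 2 + n) ((t - x + y) / 2 + n)

/-- The blocks start at `i` and at `j = J + x`. The shift by `n` turns the surface `t = x - y` into
`i = n - y`, `J = n`, `j = n + x`, with `i` and `j` in `[0, m + n]`. -/
theorem pluckerSolution_eq {m : ℕ} {n : ℤ} {κ : ℝ} {a : ℤ → ℝ} {v : ℤ → ℕ → ℝ}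
    (x y t i j J : ℤ) (ht : t = 2 * (i - n) + x + y) (hj : j = i + x + y) (hJ : J = i + y) :
    pluckerSolution m n κ a v x y t = κ * a i * a j * twoBlockDet m v x i J := by
  unfold pluckerSolution
  rw [show (t - x - y) / 2 + n = i by omega, show (t + x + y) / 2 + n = j by omega,
    show (t - x + y) / 2 + n = J by omega]

section

variable {m : ℕ} {n : ℤ} {v : ℤ → ℕ → ℝ}

theorem twoBlockDet_zero (i J : ℤ) : twoBlockDet m v 0 i J = twoBlockDet m v 0 J J :=
  twoBlockDet_congr fun k _ => by split_ifs <;> omega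

theorem twoBlockDet_self_size (i J : ℤ) : twoBlockDet m v m i J = twoBlockDet m v 0 i i :=
  twoBlockDet_congr fun k _ => by split_ifs <;> omega

theorem twoBlockDet_diag (x i : ℤ) : twoBlockDet m v x i i = twoBlockDet m v 0 i i :=
  twoBlockDet_congr fun k _ => by split_ifs <;> omega

/-- When the gap between the blocks is `n`, the other gap on the circle closes and the blocks form
one window. -/
theorem twoBlockDet_add_width (hv : ∀ s, v (s + (m + n)) = (-1 : ℝ) ^ (m - 1) • v s) (x i : ℤ)
    (hx : 0 ≤ x) (hxm : x ≤ m) :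
    twoBlockDet m v x i (i + n) = twoBlockDet m v 0 (i + x + n) (i + x + n) := by
  rw [twoBlockDet_reflect m n v hv x _ _ hx hxm, show i + n + x = i + x + n by ring,
    twoBlockDet_diag]

end

theorem octahedronRelation_pluckerSolution {m : ℕ} {n : ℤ} (hm : 0 < m) (hn : 0 < n) (κ lam : ℝ)
    {a : ℤ → ℝ} {v : ℤ → ℕ → ℝ} (ha : ∀ s, a (s + (m + n)) = lam * a s)
    (hv : ∀ s, v (s + (m + n)) = (-1 : ℝ) ^ (m - 1) • v s) :
    OctahedronRelation m n (pluckerSolution m n κ a v) := by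
  rintro x y t ⟨hx, hxm, hy, hyn, hp⟩
  simp only at hx hxm hy hyn hp
  obtain ⟨i, j, J, ht, hj, hJ⟩ : ∃ i j J : ℤ, t = 2 * (i - n) + x + y + 1 ∧ j = i + x + y ∧
      J = i + y := by
    obtain ⟨r, hr⟩ := hp
    exact ⟨r - x - y - 1 + n, _, _, by omega, rfl, rfl⟩
  rw [pluckerSolution_eq x y (t + 1) (i + 1) (j + 1) (J + 1) (by omega) (by omega) (by omega),
    pluckerSolution_eq x y (t - 1) i j J (by omega) (by omega) (by omega),
    pluckerSolution_eq (x + 1) y t i (j + 1) J (by omega) (by omega) (by omega),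
    pluckerSolution_eq (x - 1) y t (i + 1) j (J + 1) (by omega) (by omega) (by omega),
    pluckerSolution_eq x (y + 1) t i (j + 1) (J + 1) (by omega) (by omega) (by omega),
    pluckerSolution_eq x (y - 1) t (i + 1) j J (by omega) (by omega) (by omega)]
  refine ⟨?_, ?_, ?_, ?_, ?_, ?_, ?_⟩
  · intro hx0 hxm' _ _
    linear_combination κ ^ 2 * a i * a j * a (i + 1) * a (j + 1) *
      twoBlockDet_plucker m v x i J hx0 hxm'
  · rintro hx0 hxm' (rfl | rfl)
    · obtain rfl : J = i := by omega
      simp only [twoBlockDet_diag x, twoBlockDet_diag (x + 1), twoBlockDet_diag (x - 1)]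
      ring
    · subst hJ
      rw [show i + y + 1 = i + 1 + y by ring, twoBlockDet_add_width hv x i hx hxm,
        twoBlockDet_add_width hv x (i + 1) hx hxm,
        twoBlockDet_add_width hv (x + 1) i (by omega) (by omega),
        twoBlockDet_add_width hv (x - 1) (i + 1) (by omega) (by omega),
        show i + 1 + x + y = i + (x + 1) + y by ring,
        show i + 1 + (x - 1) + y = i + x + y by ring]
      ring
  · rintro hy0 hyn' (rfl | rfl)
    · simp only [twoBlockDet_zero i, twoBlockDet_zero (i + 1)]
      ring
    · simp only [twoBlockDet_self_size]
      ring
  · rintro rfl rfl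
    obtain rfl : J = i := by omega
    obtain rfl : j = J := by omega
    simp only [twoBlockDet_zero j, twoBlockDet_diag, zero_add]
    ring
  · rintro rfl rfl
    have h1 := twoBlockDet_add_width hv 1 i (by omega) (by omega)
    rw [← hJ, show i + 1 + y = J + 1 by omega] at h1
    simp only [zero_add, h1, twoBlockDet_zero i, twoBlockDet_zero (i + 1)]
    ring
  · rintro rfl rfl
    obtain rfl : J = i := by omega
    simp only [twoBlockDet_self_size, twoBlockDet_diag]
    ring
  · rintro rfl rfl
    have h1 := twoBlockDet_add_width hv (m - 1 : ℤ) (i + 1) (by omega) (by omega)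
    rw [show i + 1 + (m - 1 : ℤ) + y = i + (m + y) by ring,
      twoBlockDet_add_period m y v hv 0 i i le_rfl (by omega),
      show i + 1 + y = J + 1 by omega] at h1
    -- At this edge `j = i + m + n`, and the scalar factors match only through the quasi-periodicity
    -- of `a`.
    have h2 := ha i
    have h3 := ha (i + 1)
    rw [show i + (m + y) = j by omega] at h2
    rw [show i + 1 + (m + y) = j + 1 by omega] at h3
    simp only [twoBlockDet_self_size, h1, h2, h3]
    ring

theorem pluckerSolution_symm {m : ℕ} {n : ℤ} (κ lam : ℝ)
    {a : ℤ → ℝ} {v : ℤ → ℕ → ℝ} (ha : ∀ s, a (s + (m + n)) = lam * a s)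
    (hv : ∀ s, v (s + (m + n)) = (-1 : ℝ) ^ (m - 1) • v s) {x y t : ℤ}
    (h : (x, y, t) ∈ boundedLattice m n) :
    pluckerSolution m n κ a v x y t =
      lam * pluckerSolution m n κ a v (m - x) (n - y) (t - m - n) := by
  obtain ⟨hx, hxm, hy, hyn, r, hr⟩ := h
  simp only at hx hxm hy hyn hr
  have ht : t = 2 * ((r - x - y + n) - n) + x + y := by omega
  generalize r - x - y + n = i at ht
  rw [pluckerSolution_eq x y t i (i + x + y) (i + y) ht rfl rfl,
    pluckerSolution_eq (m - x) (n - y) (t - m - n) (i + x + y - (m + n)) i (i + x - m)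
      (by omega) (by omega) (by omega),
    twoBlockDet_reflect m n v hv x _ _ hx hxm,
    ← twoBlockDet_add_period m n v hv (m - x) (i + x + y - (m + n)) _ (by omega) (by omega)]
  have h1 := ha (i + x + y - (m + n))
  rw [sub_add_cancel] at h1
  rw [h1, sub_add_cancel, show i + x - m + (m + n) = i + x + n by ring,
    show i + y + x = i + x + y by ring]
  ring

theorem exists_real_solution {m n : ℕ} (hm : 0 < m) (hn : 0 < n) (d : ℤ × ℤ → ℝ)
    (hd : ∀ s, 0 < d s) :
    ∃ g : ℤ → ℤ → ℤ → ℝ, OctahedronRelation m n g ∧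
      (∀ x y : ℤ, 0 ≤ x → x ≤ m → 0 ≤ y → y ≤ n → g x y (x - y) = d (x, y)) ∧
      ∃ lam : ℝ, ∀ x y t : ℤ, (x, y, t) ∈ boundedLattice m n →
        g x y t = lam * g (m - x) (n - y) (t - m - n) := by
  have hN : (0 : ℤ) < m + n := by omega
  have hd' : ∀ s, d s ≠ 0 := fun s => (hd s).ne'
  -- The minors are normalised to `1` for `x = 0` and for `y = 0`, so `a` is read off from the data
  -- on these two sides.
  let a₀ : ℤ → ℝ := fun s => if (n : ℤ) ≤ s then d (s - n, 0) / d (0, 0) else d (0, n - s) / d (0, 0)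
  have ha₀ : ∀ s, a₀ s ≠ 0 := by
    intro s
    simp only [a₀]
    split_ifs
    · exact div_ne_zero (hd' _) (hd' _)
    · exact div_ne_zero (hd' _) (hd' _)
  -- The index `m + n`, needed for `x = m`, lies just past one period; this `lam` makes the
  -- extension agree with `a₀` there too.
  let lam : ℝ := a₀ (m + n) / a₀ 0
  have hlam : lam ≠ 0 := div_ne_zero (ha₀ _) (ha₀ _)
  let a : ℤ → ℝ := quasiPeriodicExt (m + n) lam a₀
  have ha : ∀ s, a (s + (m + n)) = lam * a s := quasiPeriodicExt_add hN hlam a₀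
  have ha_eq : ∀ s : ℤ, 0 ≤ s → s ≤ m + n → a s = a₀ s := by
    intro s h0 hs
    obtain hs | rfl := hs.lt_or_eq
    · exact quasiPeriodicExt_of_lt _ _ h0 hs
    · have h1 := ha 0
      have h2 : a 0 = a₀ 0 := quasiPeriodicExt_of_lt _ _ le_rfl hN
      rw [zero_add, h2] at h1
      rw [h1]
      exact div_mul_cancel₀ _ (ha₀ 0)
  -- What remains of `d (b, n - s)` after division by `d (0, 0) * a s * a (n + b)`.
  let e : ℕ → ℕ → ℝ := fun b s =>
    d (b, n - s) * d (0, 0) / (d (0, n - s) * d (b, 0))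
  obtain ⟨w, hw0, hw⟩ := exists_leadingMinor_eq n e
    (fun s => by
      have h1 := hd' (0, (n : ℤ) - s)
      have h2 := hd' (0, 0)
      simp only [e, Nat.cast_zero]
      field_simp)
    (fun b s => div_ne_zero (mul_ne_zero (hd' _) (hd' _)) (mul_ne_zero (hd' _) (hd' _))) m
  have he1 : ∀ b, e b n = 1 := by
    intro b
    have h1 := hd' ((b : ℤ), 0)
    have h2 := hd' (0, 0)
    simp only [e, sub_self]
    field_simp
  have hw1 : ∀ l < m, w l (n + l) = 1 := by
    intro l hl
    have h := leadingMinor_succ_of_vanish hw0 l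
    rw [hw _ hl n le_rfl, hw _ hl.le n le_rfl, he1, he1, mul_one] at h
    exact h.symm
  let v : ℤ → ℕ → ℝ := quasiPeriodicExt (m + n) ((-1) ^ (m - 1)) fun s l => w l s.toNat
  have hv : ∀ s, v (s + (m + n)) = (-1 : ℝ) ^ (m - 1) • v s :=
    quasiPeriodicExt_add hN (pow_ne_zero _ (by norm_num)) _
  refine ⟨pluckerSolution m n (d (0, 0)) a v,
    octahedronRelation_pluckerSolution hm (by omega) _ lam ha hv, ?_,
    lam, fun x y t h => pluckerSolution_symm _ lam ha hv h⟩
  intro x y hx hxm hy hyn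
  rw [pluckerSolution_eq x y (x - y) (n - y) (n + x) n (by omega) (by omega) (by omega)]
  lift x to ℕ using hx
  lift y to ℕ using hy
  have hdet : twoBlockDet m v x (n - y) n = e x (n - y) := by
    rw [← hw x (by omega) (n - y) (by omega),
      ← det_unitriangular_tail hw0 hw1 x (n - y) m (by omega) le_rfl]
    unfold twoBlockDet
    congr 1
    ext k l
    simp only [twoBlockMatrix, Matrix.of_apply, v]
    rw [quasiPeriodicExt_of_lt _ _ (by split_ifs <;> omega) (by split_ifs <;> omega)]
    congr 1
    split_ifs <;> omega
  have hy1 : a (n - y) = d (0, y) / d (0, 0) := by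
    rw [ha_eq _ (by omega) (by omega)]
    simp only [a₀]
    split_ifs with h
    · obtain rfl : y = 0 := by omega
      simp
    · rw [sub_sub_cancel]
  have hx1 : a (n + x) = d (x, 0) / d (0, 0) := by
    rw [ha_eq _ (by omega) (by omega)]
    simp only [a₀]
    rw [if_pos (by omega), add_sub_cancel_left]
  rw [hdet, hy1, hx1]
  simp only [e]
  rw [Nat.cast_sub (by omega), sub_sub_cancel]
  have h1 := hd' (0, 0)
  have h2 := hd' ((x : ℤ), 0)
  have h3 := hd' (0, (y : ℤ))
  field_simp

/-! ### Propagation from the initial surface, and conclusion. -/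

theorem SatisfiesBoundedOctahedron.octahedronRelation {F : Type*} [CommGroup F]
    [AddCommSemigroup F] {m n : ℤ} {f : ℤ → ℤ → ℤ → F} (hf : SatisfiesBoundedOctahedron m n f) :
    OctahedronRelation m n f := by
  intro x y t h
  simpa only [eq_div_iff_mul_eq'] using hf x y t h

theorem sub_le_of_abs_add_abs_eq_one {x y x' y' : ℤ} (h : |x' - x| + |y' - y| = 1) :
    x' - y' ≤ x - y + 1 ∧ x - y ≤ x' - y' + 1 := by
  have h1 := le_abs_self (x' - x)
  have h2 := neg_abs_le (x' - x)
  have h3 := le_abs_self (y' - y)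
  have h4 := neg_abs_le (y' - y)
  constructor <;> linarith

/-- Induction from the surface `t = x - y` along the steps of the octahedron recurrence. -/
theorem boundedLattice_induction {m n : ℤ} (p : ℤ → ℤ → ℤ → Prop)
    (base : ∀ x y, 0 ≤ x → x ≤ m → 0 ≤ y → y ≤ n → p x y (x - y))
    (up : ∀ x y t, (x, y, t + 1) ∈ boundedLattice m n →
      (∀ x' y', (x', y', t) ∈ boundedLattice m n → |x' - x| + |y' - y| = 1 → p x' y' t) →
      p x y (t - 1) → p x y (t + 1))
    (down : ∀ x y t, (x, y, t + 1) ∈ boundedLattice m n →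
      (∀ x' y', (x', y', t) ∈ boundedLattice m n → |x' - x| + |y' - y| = 1 → p x' y' t) →
      p x y (t + 1) → p x y (t - 1))
    (x y t : ℤ) (h : (x, y, t) ∈ boundedLattice m n) : p x y t := by
  have hup : ∀ k : ℕ, ∀ x y t : ℤ, (x, y, t) ∈ boundedLattice m n → x - y ≤ t → t + n ≤ k →
      p x y t := by
    intro k
    induction k using Nat.strong_induction_on with
    | _ k ih =>
      rintro x y t ⟨hx, hxm, hy, hyn, r, hr⟩ ht hk
      simp only at hx hxm hy hyn hr
      obtain rfl | hlt := ht.eq_or_lt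
      · exact base x y hx hxm hy hyn
      · have key := up x y (t - 1) ⟨hx, hxm, hy, hyn, r, by simp only; omega⟩
        rw [sub_add_cancel] at key
        refine key (fun x' y' h' hxy => ?_) ?_
        -- By parity `t` exceeds `x - y` by at least `2`, so the neighbours at height `t - 1` and
        -- the point at height `t - 2` are not below the surface.
        · have := sub_le_of_abs_add_abs_eq_one hxy
          exact ih (k - 1) (by omega) x' y' (t - 1) h' (by omega) (by omega)
        · exact ih (k - 1) (by omega) x y _
            ⟨hx, hxm, hy, hyn, r - 1, by simp only; omega⟩ (by omega) (by omega)
  have hdown : ∀ k : ℕ, ∀ x y t : ℤ, (x, y, t) ∈ boundedLattice m n → t ≤ x - y → m - t ≤ k →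
      p x y t := by
    intro k
    induction k using Nat.strong_induction_on with
    | _ k ih =>
      rintro x y t ⟨hx, hxm, hy, hyn, r, hr⟩ ht hk
      simp only at hx hxm hy hyn hr
      obtain rfl | hlt := ht.eq_or_lt
      · exact base x y hx hxm hy hyn
      · have key := down x y (t + 1) ⟨hx, hxm, hy, hyn, r + 1, by simp only; omega⟩
        rw [add_sub_cancel_right] at key
        refine key (fun x' y' h' hxy => ?_) ?_
        · have := sub_le_of_abs_add_abs_eq_one hxy
          exact ih (k - 1) (by omega) x' y' (t + 1) h' (by omega) (by omega)
        · exact ih (k - 1) (by omega) x y _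
            ⟨hx, hxm, hy, hyn, r + 1, by simp only; omega⟩ (by omega) (by omega)
  obtain ht | ht := le_total (x - y) t
  · exact hup (t + n).toNat x y t h ht (by omega)
  · exact hdown (m - t).toNat x y t h ht (by omega)

theorem SubtractionFreeLift.of_octahedronRelation_step {F σ : Type*} [CommGroup F]
    [AddCommSemigroup F] [LeftDistribClass F] {φ : σ → F} {m n : ℤ} (hm : 0 < m) (hn : 0 < n)
    {f : ℤ → ℤ → ℤ → F} (hf : OctahedronRelation m n f) {g : (σ → ℝ) → ℤ → ℤ → ℤ → ℝ}
    (hg : ∀ d, OctahedronRelation m n (g d)) {x y t : ℤ}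
    (h : (x, y, t + 1) ∈ boundedLattice m n)
    (ih : ∀ x' y', (x', y', t) ∈ boundedLattice m n → |x' - x| + |y' - y| = 1 →
      SubtractionFreeLift φ (f x' y' t) (fun d => g d x' y' t)) :
    SubtractionFreeLift φ (f x y (t + 1) * f x y (t - 1))
      (fun d => g d x y (t + 1) * g d x y (t - 1)) := by
  obtain ⟨hx, hxm, hy, hyn, r, hr⟩ := id h
  simp only at hx hxm hy hyn hr
  have hf' := hf x y t h
  have hg' := fun d => hg d x y t h
  have E : x + 1 ≤ m → SubtractionFreeLift φ (f (x + 1) y t) (fun d => g d (x + 1) y t) :=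
    fun hb => ih _ _ ⟨by simp only; omega, hb, hy, hyn, r, by simp only; omega⟩ (by simp)
  have W : 0 ≤ x - 1 → SubtractionFreeLift φ (f (x - 1) y t) (fun d => g d (x - 1) y t) :=
    fun hb => ih _ _ ⟨hb, by simp only; omega, hy, hyn, r - 1, by simp only; omega⟩ (by simp)
  have N : y + 1 ≤ n → SubtractionFreeLift φ (f x (y + 1) t) (fun d => g d x (y + 1) t) :=
    fun hb => ih _ _ ⟨hx, hxm, by simp only; omega, hb, r, by simp only; omega⟩ (by simp)
  have S : 0 ≤ y - 1 → SubtractionFreeLift φ (f x (y - 1) t) (fun d => g d x (y - 1) t) :=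
    fun hb => ih _ _ ⟨hx, hxm, hb, by simp only; omega, r - 1, by simp only; omega⟩ (by simp)
  obtain ⟨f1, f2, f3, f4, f5, f6, f7⟩ := hf'
  by_cases hx0 : x = 0
  · by_cases hy0 : y = 0
    · rw [f4 hx0 hy0]
      exact ((E (by omega)).mul (N (by omega))).congr_right
        fun d _ => (hg' d).2.2.2.1 hx0 hy0
    by_cases hy1 : y = n
    · rw [f5 hx0 hy1]
      exact ((E (by omega)).mul (S (by omega))).congr_right
        fun d _ => (hg' d).2.2.2.2.1 hx0 hy1
    · rw [f3 (by omega) (by omega) (.inl hx0)]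
      exact ((N (by omega)).mul (S (by omega))).congr_right
        fun d _ => (hg' d).2.2.1 (by omega) (by omega) (.inl hx0)
  by_cases hx1 : x = m
  · by_cases hy0 : y = 0
    · rw [f6 hx1 hy0]
      exact ((W (by omega)).mul (N (by omega))).congr_right
        fun d _ => (hg' d).2.2.2.2.2.1 hx1 hy0
    by_cases hy1 : y = n
    · rw [f7 hx1 hy1]
      exact ((W (by omega)).mul (S (by omega))).congr_right
        fun d _ => (hg' d).2.2.2.2.2.2 hx1 hy1
    · rw [f3 (by omega) (by omega) (.inr hx1)]
      exact ((N (by omega)).mul (S (by omega))).congr_right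
        fun d _ => (hg' d).2.2.1 (by omega) (by omega) (.inr hx1)
  by_cases hy0 : y = 0 ∨ y = n
  · rw [f2 (by omega) (by omega) hy0]
    exact ((E (by omega)).mul (W (by omega))).congr_right
      fun d _ => (hg' d).2.1 (by omega) (by omega) hy0
  · rw [f1 (by omega) (by omega) (by omega) (by omega)]
    exact (((E (by omega)).mul (W (by omega))).add ((N (by omega)).mul (S (by omega)))).congr_right
      fun d _ => (hg' d).1 (by omega) (by omega) (by omega) (by omega)

theorem subtractionFreeLift_solution {F : Type*} [CommGroup F]
    [AddCommSemigroup F] [LeftDistribClass F] {m n : ℤ} (hm : 0 < m) (hn : 0 < n)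
    {f : ℤ → ℤ → ℤ → F} (hf : OctahedronRelation m n f) {g : (ℤ × ℤ → ℝ) → ℤ → ℤ → ℤ → ℝ}
    (hg : ∀ d, OctahedronRelation m n (g d))
    (hg0 : ∀ d : ℤ × ℤ → ℝ, (∀ s, 0 < d s) →
      ∀ x y, 0 ≤ x → x ≤ m → 0 ≤ y → y ≤ n → g d x y (x - y) = d (x, y))
    {x y t : ℤ} (h : (x, y, t) ∈ boundedLattice m n) :
    SubtractionFreeLift (fun s : ℤ × ℤ => f s.1 s.2 (s.1 - s.2)) (f x y t)
      (fun d => g d x y t) := by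
  refine boundedLattice_induction (m := m) (n := n) (fun x y t =>
    SubtractionFreeLift (fun s : ℤ × ℤ => f s.1 s.2 (s.1 - s.2)) (f x y t)
      (fun d => g d x y t)) ?_ ?_ ?_ x y t h
  · intro x y hx hxm hy hyn
    exact SubtractionFreeLift.of_var (φ := fun s : ℤ × ℤ => f s.1 s.2 (s.1 - s.2)) (x, y)
      fun d hd => hg0 d hd x y hx hxm hy hyn
  · intro x y t h ih h1
    exact h1.of_mul (.of_octahedronRelation_step hm hn hf hg h ih) rfl fun _ => rfl
  · intro x y t h ih h1
    exact h1.of_mul (.of_octahedronRelation_step hm hn hf hg h ih) (mul_comm _ _)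
      fun _ => mul_comm _ _

theorem theorem1 {F : Type*} [CommGroup F] [AddCommSemigroup F] [LeftDistribClass F]
    (m n : ℤ) (hm : 0 < m) (hn : 0 < n) (f : ℤ → ℤ → ℤ → F)
    (hf : SatisfiesBoundedOctahedron m n f) :
    ∃ c : F, ∀ x y t : ℤ, (x, y, t) ∈ boundedLattice m n →
      f x y t = c * f (m - x) (n - y) (t - m - n) := by
  lift m to ℕ using hm.le
  lift n to ℕ using hn.le
  have hsol : ∀ d : ℤ × ℤ → ℝ, ∃ g : ℤ → ℤ → ℤ → ℝ, OctahedronRelation m n g ∧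
      ((∀ s, 0 < d s) →
        (∀ x y : ℤ, 0 ≤ x → x ≤ m → 0 ≤ y → y ≤ n → g x y (x - y) = d (x, y)) ∧
        ∃ lam : ℝ, ∀ x y t : ℤ, (x, y, t) ∈ boundedLattice m n →
          g x y t = lam * g (m - x) (n - y) (t - m - n)) := by
    intro d
    by_cases hd : ∀ s, 0 < d s
    · obtain ⟨g, h1, h2⟩ := exists_real_solution (by omega : 0 < m) (by omega : 0 < n) d hd
      exact ⟨g, h1, fun _ => h2⟩
    -- The relation is required for every `d`; for data that are not positive, the zero function
    -- serves as a default.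
    · exact ⟨0, by intro x y t _; simp, fun h => absurd h hd⟩
  choose g hg hg' using hsol
  have hlift := fun {x y t : ℤ} (h : (x, y, t) ∈ boundedLattice m n) =>
    subtractionFreeLift_solution hm hn hf.octahedronRelation hg (fun d hd => (hg' d hd).1) h
  have hmem : ∀ {x y t : ℤ}, (x, y, t) ∈ boundedLattice (m : ℤ) n →
      ((m : ℤ) - x, (n : ℤ) - y, t - m - n) ∈ boundedLattice (m : ℤ) n := by
    rintro x y t ⟨hx, hxm, hy, hyn, r, hr⟩
    simp only at hx hxm hy hyn hr
    exact ⟨by simp only; omega, by simp only; omega, by simp only; omega, by simp only; omega,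
      r - x - y, by simp only; omega⟩
  have h0 : ((m : ℤ), (n : ℤ), (m + n : ℤ)) ∈ boundedLattice (m : ℤ) n :=
    ⟨hm.le, le_rfl, hn.le, le_rfl, m + n, rfl⟩
  -- The constant is forced by the point `(m, n, m + n)`, whose image is the origin.
  -- Cross-multiplying with this point removes `lam`, which depends on `d`.
  refine ⟨f m n (m + n) / f (m - m) (n - n) (m + n - m - n), fun x y t h => ?_⟩
  have key := ((hlift h).mul (hlift (hmem h0))).eq_of_eq
    ((hlift h0).mul (hlift (hmem h))) fun d hd => by
      obtain ⟨lam, hlam⟩ := (hg' d hd).2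
      rw [hlam x y t h, hlam m n (m + n) h0]
      ring
  rw [div_mul_eq_mul_div, eq_div_iff_mul_eq', key]
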